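/- **Theorem.** Fix constants $F\ge 1$, $K\ge 0$, $G\ge 1$, $H\ge 2$. Let $(\mathfrak A_n,\mathscr H_n,D_n)_{n\in\mathbb N}$ be a sequence of metric spectral triples which converges to a metric spectral triple $(\mathfrak A_\infty,\mathscr H_\infty,D_\infty)$ for the spectral propinquity. Let $\lambda\in\mathrm{Sp}(D_\infty)$, and suppose that there exist $\delta>0$ and $N\in\mathbb N$ such that, for all $n\ge N$, the set $(\lambda-\delta,\lambda+\delta)\cap\mathrm{Sp}(D_n)$ is a singleton, denoted by $\{\lambda_n\}$. Then $$\liminf_{n\to\infty}\operatorname{mult}(\lambda_n\mid D_n)\ \ge\ \operatorname{mult}(\lambda\mid D_\infty),$$ where $\operatorname{mult}(\mu\mid D)$ is the dimension of the eigenspace of $D$ for $\mu$ (the liminf is taken in $\mathbb N\cup\{\infty\}$). The terms are as follows. A seminorm defined on a subspace is given the value $\infty$ off that subspace. *Metric spectral triples.* A spectral triple $(\mathfrak A,\mathscr H,D)$ consists of a unital C*-algebra $\mathfrak A$, a unital *-representation of $\mathfrak A$ on a Hilbert space $\mathscr H$, and a (densely defined) self-adjoint operator $D$ on $\mathscr H$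 such that $D+i$ has a compact inverse, and such that the set of $a\in\mathfrak{sa}(\mathfrak A)$ with $a\,\mathrm{dom}(D)\subseteq\mathrm{dom}(D)$ and $[D,a]$ bounded is dense in the space $\mathfrak{sa}(\mathfrak A)$ of self-adjoint elements; on this set put $L_D(a)=\|[D,a]\|$. An $(F,K)$-quantum compact metric space $(\mathfrak A,L)$ is a unital C*-algebra with a seminorm $L$ on a dense subspace of $\mathfrak{sa}(\mathfrak A)$ such that $L(1)=0$, the set $\{L\le1\}$ is closed, $\mathrm{mk}_L(\varphi,\psi)=\sup\{|\varphi(a)-\psi(a)|:L(a)\le1\}$ is a metric on the state space $\mathscr S(\mathfrak A)$ inducing the weak* topology, and $\max\{L(\Re(ab)),L(\Im(ab))\}\le F(L(a)\|b\|+\|a\|L(b))+KL(a)L(b)$ on the domain of $L$. The spectral triple is *metric* if $(\mathfrak A,L_D)$ is a quantum compact metric space. *Metrical C*-correspondences and tunnels.* A metrical C*-correspondence $(\mathscr M,\mathsf D,\mathfrak A,L,\mathfrak B,S)$ consists of $(F,K)$-quantum compact metric spaces $(\mathfrak A,L)$ and $(\mathfrak B,S)$, a right Hilbert $\mathfrak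 B$-module $\mathscr M$ with a unital *-morphism from $\mathfrak A$ to the adjoinable operators on $\mathscr M$, and a norm $\mathsf D\ge\|\cdot\|_{\mathscr M}$ on a dense complex subspace of $\mathscr M$ with compact closed unit ball $\{\mathsf D\le1\}$, such that, on the domains, $\mathsf D(a\omega)\le G(\|a\|+L(a))\mathsf D(\omega)$ and $\max\{S(\Re\langle\omega,\eta\rangle),S(\Im\langle\omega,\eta\rangle)\}\le H\,\mathsf D(\omega)\mathsf D(\eta)$. With a metric spectral triple one associates $\mathrm{mcc}(\mathfrak A,\mathscr H,D)=(\mathscr H,\mathsf D_D,\mathfrak A,L_D,\mathbb C,0)$, where $\mathsf D_D(\xi)=\|\xi\|+\|D\xi\|$ on $\mathrm{dom}(D)$. A modular quantum isometry $(\Pi,\pi,\theta)$ consists of a continuous linear map $\Pi$ of the modules and unital *-morphisms $\pi$, $\theta$ of the left and right C*-algebras, such that $\Pi(a\omega)=\pi(a)\Pi(\omega)$, $\Pi(\omega b)=\Pi(\omega)\theta(b)$, $\theta(\langle\omega,\eta\rangle)=\langle\Pi\omega,\Pi\eta\rangle$, each map sends the domain of the corresponding (semi)norm into the domain of the target one,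 and each target (semi)norm is, on its domain, the quotient of the source one (the infimum over preimages). A tunnel $\tau$ between two spectral triples consists of a metrical C*-correspondence $(\mathscr J,\mathsf T,\mathfrak D,L_{\mathfrak D},\mathfrak E,L_{\mathfrak E})$ and modular quantum isometries $(\Pi_j,\pi_j,\theta_j)$, $j=1,2$, from it to $\mathrm{mcc}(\mathfrak A_j,\mathscr H_j,D_j)$. Its extent is the maximum, over $j$, of the Hausdorff distances from $\{\varphi\circ\pi_j:\varphi\in\mathscr S(\mathfrak A_j)\}$ to $\mathscr S(\mathfrak D)$ for $\mathrm{mk}_{L_{\mathfrak D}}$ and from $\{\psi\circ\theta_j:\psi\in\mathscr S(\mathbb C)\}$ to $\mathscr S(\mathfrak E)$ for $\mathrm{mk}_{L_{\mathfrak E}}$. *Spectral propinquity.* Write $U_j^t=\exp(itD_j)$. For $\varepsilon>0$, an $\varepsilon$-iso-iso is a pair of maps $\varsigma_1,\varsigma_2:[0,\infty)\to[0,\infty)$ vanishing at $0$ with $\big||\varsigma_j(x)+\varsigma_j(y)-z|-|x+y-\varsigma_k(z)|\big|<\varepsilon$ for all $x,y,z\in[0,1/\varepsilon]$ and $\{j,k\}=\{1,2\}$.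 The $\varepsilon$-reach of $(\tau,\varsigma_1,\varsigma_2)$ is $$\max_{\{j,k\}=\{1,2\}}\ \sup_{\mathsf D_j(\xi)\le1}\ \inf_{\mathsf D_k(\eta)\le1}\ \sup_{0\le t\le1/\varepsilon}\ \sup_{\mathsf T(\omega)\le1}\left|\langle U_j^{-t}\xi,\Pi_j(\omega)\rangle-\langle U_k^{-\varsigma_j(t)}\eta,\Pi_k(\omega)\rangle\right|,$$ where $\mathsf D_j=\mathsf D_{D_j}$, and the $\varepsilon$-magnitude is the maximum of the extent of $\tau$ and this $\varepsilon$-reach. The spectral propinquity of the two triples is the infimum of the set consisting of $\frac{\sqrt2}{2}$ and of all $\varepsilon>0$ for which there are a tunnel $\tau$ between them and an $\varepsilon$-iso-iso $(\varsigma_1,\varsigma_2)$ with $\varepsilon$-magnitude $<\varepsilon$. -/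

import Mathlib

open Filter Topology
open scoped ENNReal NNReal

universe u v u' v'

noncomputable section

/-! ### Monge-Kantorovich and Hausdorff distances

A seminorm (or norm) `N` defined on a subspace of `E` is represented by its extension
`N : E → ℝ≥0∞` with `N x = ∞` off the domain; the domain is then `{x | N x < ∞}`. -/

/-- `sup { |φ x - ψ x| : N x ≤ 1 }`. -/
def kantorovich {E : Type*} (N : E → ℝ≥0∞) (φ ψ : E → ℂ) : ℝ≥0∞ :=
  ⨆ x ∈ {x : E | N x ≤ 1}, ‖φ x - ψ x‖ₑ

/-- The distance between two families of functionals with the same index set. -/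
def kantorovichFamily {E I : Type*} (N : E → ℝ≥0∞) (Φ Ψ : I → E → ℂ) : ℝ≥0∞ :=
  ⨆ i, kantorovich N (Φ i) (Ψ i)

/-- The one-sided Hausdorff distance `sup_{x ∈ S} inf_{y ∈ T} d x y`. -/
def leftHausdorff {X : Type*} (d : X → X → ℝ≥0∞) (S T : Set X) : ℝ≥0∞ :=
  ⨆ x ∈ S, ⨅ y ∈ T, d x y

/-- The Hausdorff distance for `d`. -/
def hausdorff {X : Type*} (d : X → X → ℝ≥0∞) (S T : Set X) : ℝ≥0∞ :=
  max (leftHausdorff d S T) (leftHausdorff d T S)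

/-! ### Quantum compact metric spaces -/

/-- The state space of a unital C*-algebra: positive linear functionals with value `1` at `1`;
as a subset of `WeakDual ℂ A` it carries the weak* topology. -/
def stateSpace (A : Type*) [CStarAlgebra A] : Set (WeakDual ℂ A) :=
  {φ | φ 1 = 1 ∧ ∀ a : A, ∃ r : ℝ, 0 ≤ r ∧ φ (star a * a) = (r : ℂ)}

/-- `(A, L)` is an `(F, K)`-quantum compact metric space. -/
structure IsQCMS (F K : ℝ≥0) (A : Type*) [CStarAlgebra A] (L : A → ℝ≥0∞) : Prop where
  isSelfAdjoint : ∀ a, L a < ∞ → IsSelfAdjoint a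
  add_le : ∀ a b, L (a + b) ≤ L a + L b
  smul : ∀ (r : ℝ) (a : A), L ((r : ℂ) • a) = ‖r‖ₑ * L a
  dense : ∀ a, IsSelfAdjoint a → a ∈ closure {b | L b < ∞}
  one : L 1 = 0
  finite : ∀ φ ∈ stateSpace A, ∀ ψ ∈ stateSpace A, kantorovich L φ ψ < ∞
  separates : ∀ φ ∈ stateSpace A, ∀ ψ ∈ stateSpace A, kantorovich L φ ψ = 0 → φ = ψ
  topology : ∀ φ : stateSpace A, (𝓝 φ).HasBasis (fun ε : ℝ≥0∞ => 0 < ε)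
    (fun ε => {ψ : stateSpace A | kantorovich L φ.1 ψ.1 < ε})
  leibniz : ∀ a b, L a < ∞ → L b < ∞ →
    max (L (realPart (a * b) : A)) (L (imaginaryPart (a * b) : A)) ≤
      F * (L a * ‖b‖ₑ + ‖a‖ₑ * L b) + K * L a * L b
  closed : IsClosed {a | L a ≤ 1}

/-! ### Metrical C*-correspondences -/

set_option linter.checkUnivs false in
/-- An `A`-`B`-C*-correspondence `M` (with `M` a right Hilbert `B`-module on which `A` acts by
adjoinable operators) together with `[0, ∞]`-valued functions on `M`, `A` and `B`. The analytic
conditions on these functions are `Correspondence.IsMetrical`. -/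
structure Correspondence : Type (max u v + 1) where
  M : Type u
  A : Type u
  B : Type v
  [normedAddCommGroup : NormedAddCommGroup M]
  [normedSpace : NormedSpace ℂ M]
  [completeSpace : CompleteSpace M]
  [cstarA : CStarAlgebra A]
  [cstarB : CStarAlgebra B]
  [rightModule : Module Bᵐᵒᵖ M]
  /-- the `B`-valued inner product -/
  ip : M → M → B
  ip_add : ∀ ω η ζ, ip ω (η + ζ) = ip ω η + ip ω ζ
  ip_smul : ∀ (c : ℂ) (ω η), ip ω (c • η) = c • ip ω η
  ip_right : ∀ (b : B) (ω η), ip ω (MulOpposite.op b • η) = ip ω η * b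
  ip_star : ∀ ω η, ip ω η = star (ip η ω)
  ip_nonneg : ∀ ω, ∃ b : B, ip ω ω = star b * b
  ip_definite : ∀ ω, ip ω ω = 0 ↔ ω = 0
  norm_eq : ∀ ω, ‖ω‖ = √‖ip ω ω‖
  /-- the left action of `A`, a unital *-morphism into the adjoinable operators -/
  left : A →ₐ[ℂ] (M →L[ℂ] M)
  left_right : ∀ (a : A) (b : B) (ω : M),
    left a (MulOpposite.op b • ω) = MulOpposite.op b • left a ω
  left_adjoint : ∀ (a : A) (ω η), ip (left a ω) η = ip ω (left (star a) η)
  /-- the D-norm -/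
  DN : M → ℝ≥0∞
  /-- the seminorm on `A` -/
  LA : A → ℝ≥0∞
  /-- the seminorm on `B` -/
  LB : B → ℝ≥0∞

attribute [instance] Correspondence.normedAddCommGroup Correspondence.normedSpace
  Correspondence.completeSpace Correspondence.cstarA Correspondence.cstarB
  Correspondence.rightModule

/-- `X` is an `(F, K, G, H)`-metrical C*-correspondence. -/
structure Correspondence.IsMetrical (F K G H : ℝ≥0) (X : Correspondence.{u, v}) : Prop where
  qcmsA : IsQCMS F K X.A X.LA
  qcmsB : IsQCMS F K X.B X.LB
  add_le : ∀ ω η, X.DN (ω + η) ≤ X.DN ω + X.DN η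
  smul : ∀ (c : ℂ) (ω : X.M), X.DN (c • ω) = ‖c‖ₑ * X.DN ω
  dense : Dense {ω | X.DN ω < ∞}
  norm_le : ∀ ω, ‖ω‖ₑ ≤ X.DN ω
  compact : IsCompact {ω | X.DN ω ≤ 1}
  modular_leibniz : ∀ a ω, X.LA a < ∞ → X.DN ω < ∞ →
    X.DN (X.left a ω) ≤ G * (‖a‖ₑ + X.LA a) * X.DN ω
  inner_leibniz : ∀ ω η, X.DN ω < ∞ → X.DN η < ∞ →
    max (X.LB (realPart (X.ip ω η) : X.B)) (X.LB (imaginaryPart (X.ip ω η) : X.B)) ≤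
      H * X.DN ω * X.DN η

/-- Lipschitz morphisms of metrical C*-correspondences. -/
structure LipschitzMorphism (X : Correspondence.{u, v}) (Y : Correspondence.{u', v'}) where
  toModule : X.M →L[ℂ] Y.M
  toA : X.A →⋆ₐ[ℂ] Y.A
  toB : X.B →⋆ₐ[ℂ] Y.B
  map_left : ∀ a ω, toModule (X.left a ω) = Y.left (toA a) (toModule ω)
  map_right : ∀ (b : X.B) (ω : X.M),
    toModule (MulOpposite.op b • ω) = MulOpposite.op (toB b) • toModule ω
  map_ip : ∀ ω η, toB (X.ip ω η) = Y.ip (toModule ω) (toModule η)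
  map_domA : ∀ a, X.LA a < ∞ → Y.LA (toA a) < ∞
  map_domB : ∀ b, X.LB b < ∞ → Y.LB (toB b) < ∞
  map_domM : ∀ ω, X.DN ω < ∞ → Y.DN (toModule ω) < ∞

/-- Modular quantum isometries. -/
structure ModularQuantumIsometry (X : Correspondence.{u, v}) (Y : Correspondence.{u', v'}) extends
    LipschitzMorphism X Y where
  quotientA : ∀ a, Y.LA a < ∞ → Y.LA a = ⨅ (d : X.A) (_ : toA d = a), X.LA d
  quotientB : ∀ b, Y.LB b < ∞ → Y.LB b = ⨅ (d : X.B) (_ : toB d = b), X.LB d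
  quotientM : ∀ ω, Y.DN ω < ∞ → Y.DN ω = ⨅ (η : X.M) (_ : toModule η = ω), X.DN η

/-- A metrical tunnel, through an `(F, K, G, H)`-metrical C*-correspondence. -/
structure Tunnel (F K G H : ℝ≥0) (X₁ X₂ : Correspondence.{u, v}) where
  J : Correspondence.{u, u}
  metrical : J.IsMetrical F K G H
  fst : ModularQuantumIsometry J X₁
  snd : ModularQuantumIsometry J X₂

namespace Tunnel

variable {F K G H : ℝ≥0} {X₁ X₂ : Correspondence.{u, v}}

/-- The reversed tunnel. -/
def symm (τ : Tunnel F K G H X₁ X₂) : Tunnel F K G H X₂ X₁ :=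
  ⟨τ.J, τ.metrical, τ.snd, τ.fst⟩

end Tunnel

/-- The states of `A`, as functions on `A`. -/
def stateFunctions (A : Type*) [CStarAlgebra A] : Set (A → ℂ) :=
  (fun φ : WeakDual ℂ A => (φ : A → ℂ)) '' stateSpace A

/-- The Hausdorff distance, for the Monge-Kantorovich metric of `(D, L)`, between
`{φ ∘ π : φ a state of A}` and the state space of `D`. -/
def stateExtent {D A : Type*} [CStarAlgebra D] [CStarAlgebra A] (L : D → ℝ≥0∞)
    (π : D →⋆ₐ[ℂ] A) : ℝ≥0∞ :=
  hausdorff (kantorovich L) ((fun φ => φ ∘ π) '' stateFunctions A) (stateFunctions D)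

/-- The extent of a tunnel. -/
def Tunnel.extent {F K G H : ℝ≥0} {X₁ X₂ : Correspondence.{u, v}}
    (τ : Tunnel F K G H X₁ X₂) : ℝ≥0∞ :=
  max (max (stateExtent τ.J.LA τ.fst.toA) (stateExtent τ.J.LB τ.fst.toB))
    (max (stateExtent τ.J.LA τ.snd.toA) (stateExtent τ.J.LB τ.snd.toB))

/-! ### Unbounded operators -/

section Operator

variable {E : Type*} [NormedAddCommGroup E] [InnerProductSpace ℂ E]

/-- `R` is a bounded, everywhere defined inverse of `D - z`. -/
def IsResolventAt (D : E →ₗ.[ℂ] E) (z : ℂ) (R : E →L[ℂ] E) : Prop :=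
  (∀ x, ∃ h : R x ∈ D.domain, D ⟨R x, h⟩ - z • R x = x) ∧
    ∀ x : D.domain, R (D x - z • (x : E)) = x

/-- The spectrum of an unbounded operator: the `z` for which `D - z` has no bounded inverse. -/
def opSpectrum (D : E →ₗ.[ℂ] E) : Set ℂ :=
  {z | ¬ ∃ R : E →L[ℂ] E, IsResolventAt D z R}

/-- The eigenspace of `D` for `z` (zero if `z` is not an eigenvalue). -/
def opEigenspace (D : E →ₗ.[ℂ] E) (z : ℂ) : Submodule ℂ E where
  carrier := {x | ∃ h : x ∈ D.domain, D ⟨x, h⟩ = z • x}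
  zero_mem' := ⟨D.domain.zero_mem, by
    have : (⟨0, D.domain.zero_mem⟩ : D.domain) = 0 := rfl
    rw [this, D.map_zero, smul_zero]⟩
  add_mem' := by
    rintro x y ⟨hx, hx'⟩ ⟨hy, hy'⟩
    refine ⟨D.domain.add_mem hx hy, ?_⟩
    have : (⟨x + y, D.domain.add_mem hx hy⟩ : D.domain) = ⟨x, hx⟩ + ⟨y, hy⟩ := rfl
    rw [this, D.map_add, hx', hy', smul_add]
  smul_mem' := by
    rintro c x ⟨hx, hx'⟩
    refine ⟨D.domain.smul_mem c hx, ?_⟩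
    have : (⟨c • x, D.domain.smul_mem c hx⟩ : D.domain) = c • ⟨x, hx⟩ := rfl
    rw [this, D.map_smul, hx', smul_comm]

/-- The multiplicity of `z` for `D`: the dimension of the eigenspace, in `ℕ∞`. -/
def multiplicityAt (z : ℂ) (D : E →ₗ.[ℂ] E) : ℕ∞ :=
  Cardinal.toENat (Module.rank ℂ (opEigenspace D z))

/-- The orthogonal projection onto the eigenspace of `D` for `z`. The eigenspaces of a closed
operator, so of a self-adjoint one, are closed; the closure is written only because an
orthogonal projection is defined onto complete subspaces. -/
def eigenprojection [CompleteSpace E] (D : E →ₗ.[ℂ] E) (z : ℂ) : E →L[ℂ] E :=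
  (opEigenspace D z).topologicalClosure.starProjection

/-- The functional calculus `f(D)` for a bounded `f : ℝ → ℂ` and a self-adjoint operator `D` with
compact resolvent, that is, with `E` the Hilbert sum of the eigenspaces of `D` (all eigenvalues
being real): `f(D) x = ∑ f(μ) P_μ x`, where `P_μ` is the orthogonal projection onto the
eigenspace of `D` for `μ`. -/
def functionalCalculus [CompleteSpace E] (D : E →ₗ.[ℂ] E) (f : ℝ → ℂ) (x : E) : E :=
  ∑' μ : ℝ, f μ • eigenprojection D μ x

end Operator

/-! ### Spectral triples -/

open Classical in
/-- The graph norm of `D`, with value `∞` off the domain of `D`. -/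
def graphNorm {E : Type*} [NormedAddCommGroup E] [InnerProductSpace ℂ E]
    (D : E →ₗ.[ℂ] E) (ξ : E) : ℝ≥0∞ :=
  if h : ξ ∈ D.domain then ‖ξ‖ₑ + ‖D ⟨ξ, h⟩‖ₑ else ∞

/-- `c` bounds `[D, T]`: `T` preserves the domain of `D` and `‖[D, T] ξ‖ ≤ c ‖ξ‖` on it. -/
def CommutatorBound {E : Type*} [NormedAddCommGroup E] [InnerProductSpace ℂ E]
    (D : E →ₗ.[ℂ] E) (T : E →L[ℂ] E) (c : ℝ≥0) : Prop :=
  ∃ h : ∀ ξ : D.domain, T ξ ∈ D.domain, ∀ ξ : D.domain, ‖D ⟨T ξ, h ξ⟩ - T (D ξ)‖ ≤ c * ‖(ξ : E)‖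

/-- A spectral triple `(A, E, D)`; `E` is the Hilbert space. -/
structure SpectralTriple : Type (u + 1) where
  A : Type u
  E : Type u
  [cstarA : CStarAlgebra A]
  [normedAddCommGroup : NormedAddCommGroup E]
  [innerProductSpace : InnerProductSpace ℂ E]
  [completeSpace : CompleteSpace E]
  /-- the (unital) *-representation of `A` -/
  rep : A →⋆ₐ[ℂ] (E →L[ℂ] E)
  /-- the Dirac operator; self-adjointness includes that the domain is dense -/
  D : E →ₗ.[ℂ] E
  selfAdjoint : IsSelfAdjoint D
  compactInverse : ∃ R : E →L[ℂ] E, IsCompactOperator R ∧ IsResolventAt D (-Complex.I) R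
  dense : ∀ a : A, IsSelfAdjoint a →
    a ∈ closure {b : A | IsSelfAdjoint b ∧ ∃ c, CommutatorBound D (rep b) c}

attribute [instance] SpectralTriple.cstarA SpectralTriple.normedAddCommGroup
  SpectralTriple.innerProductSpace SpectralTriple.completeSpace

namespace SpectralTriple

/-- `L(a) = ‖[D, a]‖` (the least bound) for `a` self-adjoint, preserving the domain of `D` and with
`[D, a]` bounded; `L(a) = ∞` for the other `a`. -/
def lip (T : SpectralTriple.{u}) (a : T.A) : ℝ≥0∞ :=
  ⨅ (c : ℝ≥0) (_ : IsSelfAdjoint a ∧ CommutatorBound T.D (T.rep a) c), (c : ℝ≥0∞)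

/-- A spectral triple is metric when `(A, L)` is a quantum compact metric space. -/
def IsMetric (F K : ℝ≥0) (T : SpectralTriple.{u}) : Prop :=
  IsQCMS F K T.A T.lip

open Classical in
/-- The C*-correspondence `(E, ‖·‖ + ‖D ·‖, A, L, ℂ, 0)` of a spectral triple; the seminorm `0` is
defined on the self-adjoint elements of `ℂ`. -/
def mcc (T : SpectralTriple.{u}) : Correspondence.{u, 0} where
  M := T.E
  A := T.A
  B := ℂ
  rightModule := Module.compHom T.E (RingEquiv.toOpposite ℂ).symm.toRingHom
  ip := fun x y => inner ℂ x y
  ip_add := fun x y z => inner_add_right x y z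
  ip_smul := fun c x y => inner_smul_right x y c
  ip_right := fun b x y => (inner_smul_right x y b).trans (mul_comm _ _)
  ip_star := fun x y => (inner_conj_symm x y).symm
  ip_nonneg := fun x => ⟨(‖x‖ : ℂ), by
    rw [inner_self_eq_norm_sq_to_K]
    simp [sq]⟩
  ip_definite := fun x => inner_self_eq_zero
  norm_eq := fun x => by
    rw [inner_self_eq_norm_sq_to_K]
    simp
  left := (T.rep : T.A →ₐ[ℂ] (T.E →L[ℂ] T.E))
  left_right := fun a b x => (T.rep a).map_smul b x
  left_adjoint := fun a x y => by
    have h : T.rep (star a) = ContinuousLinearMap.adjoint (T.rep a) := map_star T.rep a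
    change inner ℂ (T.rep a x) y = inner ℂ x (T.rep (star a) y)
    rw [h, ContinuousLinearMap.adjoint_inner_right]
  DN := graphNorm T.D
  LA := T.lip
  LB := fun z => if IsSelfAdjoint z then 0 else ∞

/-- The unitary `U^t = exp(i t D)`. -/
def U (T : SpectralTriple.{u}) (t : ℝ) : T.E → T.E :=
  functionalCalculus T.D (fun μ => Complex.exp (Complex.I * t * μ))

end SpectralTriple

/-! ### The spectral propinquity -/

/-- `ε`-iso-isos of `[0, ∞)`. -/
def IsIsoIso (ε : ℝ) (ς₁ ς₂ : ℝ≥0 → ℝ≥0) : Prop :=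
  ς₁ 0 = 0 ∧ ς₂ 0 = 0 ∧ ∀ x y z : ℝ≥0, (x : ℝ) ≤ 1 / ε → (y : ℝ) ≤ 1 / ε → (z : ℝ) ≤ 1 / ε →
    abs (|(ς₁ x : ℝ) + ς₁ y - z| - |(x : ℝ) + y - ς₂ z|) < ε ∧
    abs (|(ς₂ x : ℝ) + ς₂ y - z| - |(x : ℝ) + y - ς₁ z|) < ε

section Propinquity

variable {F K G H : ℝ≥0} {T₁ T₂ : SpectralTriple.{u}}

/-- The half reach of a tunnel `τ`: the one-sided Hausdorff distance from
`{(⟨U₁^{-t} ξ, Π₁(·)⟩)_{0 ≤ t ≤ 1/ε} : DN₁ ξ ≤ 1}` to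
`{(⟨U₂^{-ς(t)} ξ, Π₂(·)⟩)_{0 ≤ t ≤ 1/ε} : DN₂ ξ ≤ 1}`, for the D-norm of the tunnel. -/
def Tunnel.halfReach (τ : Tunnel F K G H T₁.mcc T₂.mcc) (ς : ℝ≥0 → ℝ≥0) (ε : ℝ) : ℝ≥0∞ :=
  leftHausdorff (kantorovichFamily τ.J.DN)
    ((fun (ξ : T₁.E) (t : {t : ℝ≥0 // (t : ℝ) ≤ 1 / ε}) (ω : τ.J.M) =>
      T₁.mcc.ip (T₁.U (-(t.1 : ℝ)) ξ) (τ.fst.toModule ω)) '' {ξ | graphNorm T₁.D ξ ≤ 1})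
    ((fun (ξ : T₂.E) (t : {t : ℝ≥0 // (t : ℝ) ≤ 1 / ε}) (ω : τ.J.M) =>
      T₂.mcc.ip (T₂.U (-(ς t.1 : ℝ)) ξ) (τ.snd.toModule ω)) '' {ξ | graphNorm T₂.D ξ ≤ 1})

/-- The `ε`-reach of `(τ, ς₁, ς₂)`. -/
def Tunnel.reach (τ : Tunnel F K G H T₁.mcc T₂.mcc) (ς₁ ς₂ : ℝ≥0 → ℝ≥0) (ε : ℝ) : ℝ≥0∞ :=
  max (τ.halfReach ς₁ ε) (τ.symm.halfReach ς₂ ε)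

/-- The `ε`-magnitude of `(τ, ς₁, ς₂)`. -/
def Tunnel.magnitude (τ : Tunnel F K G H T₁.mcc T₂.mcc) (ς₁ ς₂ : ℝ≥0 → ℝ≥0) (ε : ℝ) : ℝ≥0∞ :=
  max τ.extent (τ.reach ς₁ ς₂ ε)

end Propinquity

/-- The spectral propinquity, for the class of `(F, K, G, H)`-metrical C*-correspondences. -/
def spectralPropinquity (F K G H : ℝ≥0) (T₁ T₂ : SpectralTriple.{u}) : ℝ :=
  sInf (insert (√2 / 2) {ε : ℝ | 0 < ε ∧ ∃ (τ : Tunnel F K G H T₁.mcc T₂.mcc) (ς₁ ς₂ : ℝ≥0 → ℝ≥0),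
    IsIsoIso ε ς₁ ς₂ ∧ τ.magnitude ς₁ ς₂ ε < ENNReal.ofReal ε})

end

/-! ### Eigenspaces of a self-adjoint operator -/

section Operator

variable {E : Type*} [NormedAddCommGroup E] [InnerProductSpace ℂ E]

/-! Orthonormal eigenvectors of the limit operator for `lam` are carried through a tunnel of
magnitude below `ε` to vectors that nearly lie in the eigenspace of `D_n` for `λ_n` and stay nearly
orthogonal. Once `ε` is small their projections to that eigenspace are linearly independent, so its
dimension is at least as large.

Being an eigenvector is read off from the orbit: `exp(-itD) ξ` is `exp(-it lam) ξ`. The reach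
matches `ξ` with a vector `ζ` whose whole orbit, for `0 ≤ t ≤ 1/ε`, induces almost the same
functionals on the unit ball of the D-norm of the tunnel. Vectors of bounded graph norm lift to that
ball, so closeness of functionals becomes closeness in norm, and `exp(-itD_n) ζ` is within `√(8ε) +
ε` of `exp(-it lam) ζ` (`exists_norm_functionalCalculus_sub_smul_le`). Averaging over `t` then
bounds the components of `ζ` in eigenspaces at distance at least `2ε` from `lam`; by the gap `δ`,
only the component at `λ_n` is left (`IsSelfAdjoint.norm_sub_eigenprojection_le`).

For the inner products, the extent controls the two morphisms from the right algebra of the tunnel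
to `ℂ`, and the inner Leibniz inequality makes them nearly agree on inner products of lifts
(`Tunnel.norm_inner_sub_inner_le`). Hence the Gram matrix of the `ζ i` is close to that of the
original vectors (`norm_inner_sub_inner_le`), and diagonal dominance gives independence
(`linearIndependent_of_norm_inner_sub_le`). All this is assembled in
`Tunnel.natCast_le_multiplicityAt`.

Completeness of the eigenspaces is not needed: vectors are first replaced by the sum of their
spectral components. -/

theorem mem_opEigenspace_iff {D : E →ₗ.[ℂ] E} {z : ℂ} {x : E} :
    x ∈ opEigenspace D z ↔ (x, z • x) ∈ D.graph := by
  rw [LinearPMap.mem_graph_iff]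
  constructor
  · rintro ⟨h, hx⟩
    exact ⟨⟨x, h⟩, rfl, hx⟩
  · rintro ⟨y, hy, h⟩
    have hy : (y : E) = x := hy
    subst hy
    exact ⟨y.2, h⟩

theorem mem_opSpectrum_of_mem_opEigenspace {D : E →ₗ.[ℂ] E} {z : ℂ} {x : E}
    (hx : x ∈ opEigenspace D z) (h0 : x ≠ 0) : z ∈ opSpectrum D := by
  rintro ⟨R, -, hR⟩
  obtain ⟨h, hx⟩ := hx
  have := hR ⟨x, h⟩
  rw [hx, sub_self, map_zero] at this
  exact h0 this.symm

variable [CompleteSpace E] {D : E →ₗ.[ℂ] E} (hD : IsSelfAdjoint D)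

include hD

theorem IsSelfAdjoint.inner_apply_comm (x y : D.domain) :
    inner ℂ (D x) (y : E) = inner ℂ (x : E) (D y) := by
  have h := LinearPMap.adjoint_isFormalAdjoint hD.dense_domain
  rw [LinearPMap.isSelfAdjoint_def.mp hD] at h
  exact h x y

theorem IsSelfAdjoint.isClosed_opEigenspace (z : ℂ) : IsClosed (opEigenspace D z : Set E) := by
  have h : IsClosed (D.graph : Set (E × E)) := hD.isClosed
  have h2 : (opEigenspace D z : Set E) = (fun x => (x, z • x)) ⁻¹' (D.graph : Set (E × E)) := by
    ext x
    exact mem_opEigenspace_iff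
  rw [h2]
  exact h.preimage (by fun_prop)

theorem IsSelfAdjoint.topologicalClosure_opEigenspace (z : ℂ) :
    (opEigenspace D z).topologicalClosure = opEigenspace D z :=
  (hD.isClosed_opEigenspace z).submodule_topologicalClosure_eq

theorem IsSelfAdjoint.eigenprojection_mem (z : ℂ) (x : E) :
    eigenprojection D z x ∈ opEigenspace D z := by
  rw [← hD.topologicalClosure_opEigenspace z]
  exact Submodule.starProjection_apply_mem _ _

omit hD in
theorem eigenprojection_eq_self {z : ℂ} {x : E} (hx : x ∈ opEigenspace D z) :
    eigenprojection D z x = x :=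
  Submodule.starProjection_eq_self_iff.mpr (Submodule.le_topologicalClosure _ hx)

omit hD in
theorem inner_eigenprojection_left {z : ℂ} {x y : E} (hy : y ∈ opEigenspace D z) :
    inner ℂ (eigenprojection D z x) y = inner ℂ x y := by
  have := (opEigenspace D z).topologicalClosure.starProjection_inner_eq_zero x y
    (Submodule.le_topologicalClosure _ hy)
  rw [inner_sub_left, sub_eq_zero] at this
  exact this.symm

omit hD in
theorem inner_eigenprojection_comm (z : ℂ) (x y : E) :
    inner ℂ (eigenprojection D z x) y = inner ℂ x (eigenprojection D z y) :=
  Submodule.inner_starProjection_left_eq_right _ _ _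

theorem IsSelfAdjoint.inner_opEigenspace_eq_zero {μ ν : ℝ} (h : μ ≠ ν) {x y : E}
    (hx : x ∈ opEigenspace D μ) (hy : y ∈ opEigenspace D ν) : inner ℂ x y = 0 := by
  obtain ⟨hx, hx'⟩ := hx
  obtain ⟨hy, hy'⟩ := hy
  have := hD.inner_apply_comm ⟨x, hx⟩ ⟨y, hy⟩
  rw [hx', hy'] at this
  simp only [inner_smul_left, inner_smul_right, Complex.conj_ofReal] at this
  by_contra h0
  exact h (by exact_mod_cast mul_right_cancel₀ h0 this)

theorem IsSelfAdjoint.orthogonalFamily_opEigenspace :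
    OrthogonalFamily ℂ (fun μ : ℝ => opEigenspace D μ) fun μ => (opEigenspace D μ).subtypeₗᵢ :=
  fun _ _ h x y => hD.inner_opEigenspace_eq_zero h x.2 y.2

theorem IsSelfAdjoint.eigenprojection_eq_zero {μ ν : ℝ} (h : μ ≠ ν) {x : E}
    (hx : x ∈ opEigenspace D ν) : eigenprojection D μ x = 0 := by
  rw [← inner_self_eq_zero (𝕜 := ℂ), inner_eigenprojection_left (hD.eigenprojection_mem _ _)]
  exact hD.inner_opEigenspace_eq_zero h.symm hx (hD.eigenprojection_mem _ _)

theorem IsSelfAdjoint.eigenprojection_apply (μ : ℝ) (x : D.domain) :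
    eigenprojection D μ (D x) = (μ : ℂ) • eigenprojection D μ (x : E) := by
  refine ext_inner_right ℂ fun v => ?_
  obtain ⟨h, hv⟩ := hD.eigenprojection_mem μ v
  rw [inner_eigenprojection_comm, hD.inner_apply_comm x ⟨_, h⟩, hv, inner_smul_left,
    inner_smul_right, Complex.conj_ofReal, inner_eigenprojection_comm]

theorem IsSelfAdjoint.norm_sum_smul_eigenprojection_sq (f : ℝ → ℂ) (x : E) (s : Finset ℝ) :
    ‖∑ μ ∈ s, f μ • eigenprojection D μ x‖ ^ 2 =
      ∑ μ ∈ s, ‖f μ‖ ^ 2 * ‖eigenprojection D μ x‖ ^ 2 := by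
  have := hD.orthogonalFamily_opEigenspace.norm_sum
    (fun μ => f μ • ⟨eigenprojection D μ x, hD.eigenprojection_mem _ _⟩) s
  simpa [norm_smul, mul_pow] using this

/-- Bessel's inequality. -/
theorem IsSelfAdjoint.sum_norm_eigenprojection_sq_le (x : E) (s : Finset ℝ) :
    ∑ μ ∈ s, ‖eigenprojection D μ x‖ ^ 2 ≤ ‖x‖ ^ 2 := by
  set y := ∑ μ ∈ s, eigenprojection D μ x with hy
  have h1 : ‖y‖ ^ 2 = ∑ μ ∈ s, ‖eigenprojection D μ x‖ ^ 2 := by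
    simpa using hD.norm_sum_smul_eigenprojection_sq (fun _ => 1) x s
  have h2 : inner ℂ y x = ((‖y‖ ^ 2 : ℝ) : ℂ) := by
    rw [h1, hy, sum_inner]
    push_cast
    refine Finset.sum_congr rfl fun μ _ => ?_
    rw [← inner_conj_symm, ← inner_eigenprojection_left (hD.eigenprojection_mem μ x),
      inner_conj_symm]
    exact inner_self_eq_norm_sq_to_K _
  have h3 : ‖y‖ ^ 2 ≤ ‖y‖ * ‖x‖ := by
    have := norm_inner_le_norm (𝕜 := ℂ) y x
    rwa [h2, Complex.norm_real, Real.norm_of_nonneg (sq_nonneg _)] at this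
  rw [← h1]
  have h4 : ‖y‖ ≤ ‖x‖ := by
    rcases (norm_nonneg y).eq_or_lt with h | h
    · exact h ▸ norm_nonneg x
    · exact le_of_mul_le_mul_left (by rwa [sq] at h3) h
  gcongr

/-- The terms are pairwise orthogonal, so square-summability of their norms suffices, and that
follows from Bessel's inequality. -/
theorem IsSelfAdjoint.summable_functionalCalculus {f : ℝ → ℂ} {B : ℝ} (hf : ∀ μ, ‖f μ‖ ≤ B)
    (x : E) : Summable fun μ : ℝ => f μ • eigenprojection D μ x := by
  suffices h : Summable fun μ : ℝ =>
      ‖f μ • (⟨eigenprojection D μ x, hD.eigenprojection_mem _ _⟩ : opEigenspace D μ)‖ ^ 2 by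
    simpa using (hD.orthogonalFamily_opEigenspace.summable_iff_norm_sq_summable _).mpr h
  refine summable_of_sum_le (c := B ^ 2 * ‖x‖ ^ 2) (fun _ => sq_nonneg _) fun s => ?_
  refine le_trans ?_ (mul_le_mul_of_nonneg_left (hD.sum_norm_eigenprojection_sq_le x s)
    (sq_nonneg B))
  rw [Finset.mul_sum]
  refine Finset.sum_le_sum fun μ _ => ?_
  rw [norm_smul, mul_pow]
  exact mul_le_mul_of_nonneg_right (pow_le_pow_left₀ (norm_nonneg _) (hf μ) 2) (sq_nonneg _)

theorem IsSelfAdjoint.hasSum_functionalCalculus {f : ℝ → ℂ} {B : ℝ} (hf : ∀ μ, ‖f μ‖ ≤ B)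
    (x : E) : HasSum (fun μ : ℝ => f μ • eigenprojection D μ x) (functionalCalculus D f x) :=
  (hD.summable_functionalCalculus hf x).hasSum

theorem IsSelfAdjoint.functionalCalculus_sub {f g : ℝ → ℂ} {B B' : ℝ} (hf : ∀ μ, ‖f μ‖ ≤ B)
    (hg : ∀ μ, ‖g μ‖ ≤ B') (x : E) : functionalCalculus D (fun μ => f μ - g μ) x =
      functionalCalculus D f x - functionalCalculus D g x := by
  have := (hD.hasSum_functionalCalculus hf x).sub (hD.hasSum_functionalCalculus hg x)
  simp only [← sub_smul] at this
  exact this.tsum_eq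

theorem IsSelfAdjoint.norm_functionalCalculus_le {f : ℝ → ℂ} {B : ℝ} (hf : ∀ μ, ‖f μ‖ ≤ B)
    {x : E} {C : ℝ} (hC : 0 ≤ C)
    (h : ∀ s : Finset ℝ, ∑ μ ∈ s, ‖f μ‖ ^ 2 * ‖eigenprojection D μ x‖ ^ 2 ≤ C ^ 2) :
    ‖functionalCalculus D f x‖ ≤ C := by
  refine le_of_tendsto (hD.hasSum_functionalCalculus hf x).norm (Eventually.of_forall fun s => ?_)
  refine le_of_sq_le_sq ?_ hC
  rw [hD.norm_sum_smul_eigenprojection_sq]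
  exact h s

theorem IsSelfAdjoint.eigenprojection_functionalCalculus {f : ℝ → ℂ} {B : ℝ}
    (hf : ∀ μ, ‖f μ‖ ≤ B) (ν : ℝ) (x : E) :
    eigenprojection D ν (functionalCalculus D f x) = f ν • eigenprojection D ν x := by
  have h := (hD.hasSum_functionalCalculus hf x).mapL (eigenprojection D ν)
  refine h.unique ?_
  have := hasSum_single (f := fun μ : ℝ =>
    eigenprojection D (ν : ℂ) (f μ • eigenprojection D μ x)) ν fun μ hμ => by
      rw [map_smul, hD.eigenprojection_eq_zero hμ.symm (hD.eigenprojection_mem μ x), smul_zero]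
  simpa [eigenprojection_eq_self (hD.eigenprojection_mem (ν : ℂ) x)] using this

theorem IsSelfAdjoint.functionalCalculus_functionalCalculus {f g : ℝ → ℂ} {B : ℝ}
    (hg : ∀ μ, ‖g μ‖ ≤ B) (x : E) :
    functionalCalculus D f (functionalCalculus D g x) =
      functionalCalculus D (fun μ => f μ * g μ) x := by
  unfold functionalCalculus
  refine tsum_congr fun μ => ?_
  rw [mul_smul]
  congr 1
  exact hD.eigenprojection_functionalCalculus hg μ x

theorem IsSelfAdjoint.functionalCalculus_of_mem_opEigenspace (f : ℝ → ℂ) {ν : ℝ} {x : E}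
    (hx : x ∈ opEigenspace D ν) : functionalCalculus D f x = f ν • x := by
  refine (tsum_eq_single ν fun μ hμ => ?_).trans ?_
  · rw [hD.eigenprojection_eq_zero hμ hx, smul_zero]
  · rw [eigenprojection_eq_self hx]

/-- `f(D)` commutes with `D`: the finite partial sums lie in the graph, which is closed. -/
theorem IsSelfAdjoint.functionalCalculus_mem_graph {f : ℝ → ℂ} {B : ℝ} (hf : ∀ μ, ‖f μ‖ ≤ B)
    (x : D.domain) :
    (functionalCalculus D f (x : E), functionalCalculus D f (D x)) ∈ D.graph := by
  have hcl : IsClosed (D.graph : Set (E × E)) := hD.isClosed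
  have h1 := hD.hasSum_functionalCalculus hf (x : E)
  have h2 := hD.hasSum_functionalCalculus hf (D x)
  refine hcl.mem_of_tendsto (h1.prodMk h2) (Eventually.of_forall fun s => ?_)
  refine Submodule.sum_mem _ fun μ _ => ?_
  rw [hD.eigenprojection_apply, smul_comm]
  exact mem_opEigenspace_iff.mp
    ((opEigenspace D μ).smul_mem _ (hD.eigenprojection_mem (μ : ℂ) (x : E)))

omit hD [CompleteSpace E] in
theorem graphNorm_le_one_iff {x : E} :
    graphNorm D x ≤ 1 ↔ ∃ h : x ∈ D.domain, ‖x‖ + ‖D ⟨x, h⟩‖ ≤ 1 := by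
  unfold graphNorm
  split_ifs with h
  · simp only [h, exists_true_left]
    rw [← ofReal_norm, ← ofReal_norm, ← ENNReal.ofReal_add (norm_nonneg _) (norm_nonneg _),
      ENNReal.ofReal_le_one]
  · simp [h]

omit hD [CompleteSpace E] in
theorem graphNorm_smul {c : ℂ} (hc : c ≠ 0) (x : E) :
    graphNorm D (c • x) = ‖c‖ₑ * graphNorm D x := by
  unfold graphNorm
  by_cases h : x ∈ D.domain
  · have h' := D.domain.smul_mem c h
    rw [dif_pos h, dif_pos h']
    have : (⟨c • x, h'⟩ : D.domain) = c • ⟨x, h⟩ := rfl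
    rw [this, D.map_smul, enorm_smul, enorm_smul, mul_add]
  · have h' : c • x ∉ D.domain := fun h' => h ((D.domain.smul_mem_iff hc).mp h')
    rw [dif_neg h, dif_neg h', ENNReal.mul_top (by simpa using hc)]

theorem IsSelfAdjoint.norm_functionalCalculus_le_norm {f : ℝ → ℂ} (hf : ∀ μ, ‖f μ‖ ≤ 1) (x : E) :
    ‖functionalCalculus D f x‖ ≤ ‖x‖ := by
  refine hD.norm_functionalCalculus_le hf (norm_nonneg x) fun s =>
    le_trans (Finset.sum_le_sum fun μ _ => ?_) (hD.sum_norm_eigenprojection_sq_le x s)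
  exact mul_le_of_le_one_left (sq_nonneg _) (pow_le_one₀ (norm_nonneg _) (hf μ))

theorem IsSelfAdjoint.graphNorm_functionalCalculus_le_one {f : ℝ → ℂ} (hf : ∀ μ, ‖f μ‖ ≤ 1)
    {x : E} (hx : graphNorm D x ≤ 1) : graphNorm D (functionalCalculus D f x) ≤ 1 := by
  rw [graphNorm_le_one_iff] at hx ⊢
  obtain ⟨h, hx⟩ := hx
  obtain ⟨y, hy, hy'⟩ := (LinearPMap.mem_graph_iff _).mp (hD.functionalCalculus_mem_graph hf ⟨x, h⟩)
  have hy : (y : E) = functionalCalculus D f x := hy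
  have hy' : D y = functionalCalculus D f (D ⟨x, h⟩) := hy'
  rw [← hy]
  refine ⟨y.2, ?_⟩
  change ‖(y : E)‖ + ‖D y‖ ≤ 1
  rw [hy, hy']
  have h1 := hD.norm_functionalCalculus_le_norm hf x
  have h2 := hD.norm_functionalCalculus_le_norm hf (D ⟨x, h⟩)
  linarith

end Operator

/-! ### The one-parameter group of a self-adjoint operator -/

/-- The character `μ ↦ exp(i t μ)`. -/
noncomputable def expCharacter (t : ℝ) : ℝ → ℂ := fun μ => Complex.exp (Complex.I * t * μ)

theorem norm_expCharacter (t μ : ℝ) : ‖expCharacter t μ‖ = 1 := by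
  unfold expCharacter
  rw [mul_assoc, ← Complex.ofReal_mul]
  exact Complex.norm_exp_I_mul_ofReal _

theorem norm_expCharacter_le (t μ : ℝ) : ‖expCharacter t μ‖ ≤ 1 := (norm_expCharacter t μ).le

theorem expCharacter_zero : expCharacter 0 = fun _ => 1 := by
  funext μ
  simp [expCharacter]

theorem norm_expCharacter_sub_le (s t μ : ℝ) :
    ‖expCharacter s μ - expCharacter t μ‖ ≤ |s - t| * |μ| := by
  have : expCharacter s μ - expCharacter t μ =
      expCharacter t μ * (Complex.exp (Complex.I * ((s - t) * μ : ℝ)) - 1) := by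
    unfold expCharacter
    rw [mul_sub, ← Complex.exp_add, mul_one]
    congr 2
    push_cast
    ring
  rw [this, norm_mul, norm_expCharacter, one_mul, ← abs_mul]
  exact Real.norm_exp_I_mul_ofReal_sub_one_le

theorem norm_expCharacter_sub_sq (t μ ν : ℝ) :
    ‖expCharacter t μ - expCharacter t ν‖ ^ 2 = 2 - 2 * Real.cos ((μ - ν) * t) := by
  have : expCharacter t μ - expCharacter t ν =
      expCharacter t ν * (Complex.exp (Complex.I * ((μ - ν) * t : ℝ)) - 1) := by
    unfold expCharacter
    rw [mul_sub, ← Complex.exp_add, mul_one]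
    congr 2
    push_cast
    ring
  rw [this, norm_mul, norm_expCharacter, one_mul, mul_comm Complex.I, ← Complex.normSq_eq_norm_sq,
    Complex.normSq_apply]
  simp only [Complex.sub_re, Complex.sub_im, Complex.exp_ofReal_mul_I_re,
    Complex.exp_ofReal_mul_I_im, Complex.one_re, Complex.one_im]
  have := Real.sin_sq_add_cos_sq ((μ - ν) * t)
  linarith

/-- With `s = μ - ν`, the integral is `2T - 2 sin(sT)/s ≥ 2T - 2/|s|`, and `2/|s| ≤ T`. -/
theorem le_integral_norm_expCharacter_sub_sq {μ ν T : ℝ} (h : 2 ≤ |μ - ν| * T) :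
    T ≤ ∫ t in (0 : ℝ)..T, ‖expCharacter t μ - expCharacter t ν‖ ^ 2 := by
  simp only [norm_expCharacter_sub_sq]
  have hs : μ - ν ≠ 0 := by
    intro h0
    rw [h0] at h
    norm_num at h
  rw [intervalIntegral.integral_sub (by simp) (Continuous.intervalIntegrable (by fun_prop) _ _),
    intervalIntegral.integral_const_mul, intervalIntegral.integral_comp_mul_left _ hs]
  simp only [intervalIntegral.integral_const, integral_cos, smul_eq_mul, mul_zero, Real.sin_zero,
    sub_zero]
  have h1 : (μ - ν)⁻¹ * Real.sin ((μ - ν) * T) ≤ T / 2 := by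
    refine (le_abs_self _).trans ?_
    rw [abs_mul, abs_inv]
    have h2 : 0 < |μ - ν| := abs_pos.mpr hs
    rw [inv_mul_le_iff₀ h2]
    have := Real.abs_sin_le_one ((μ - ν) * T)
    linarith
  linarith

section Operator

variable {E : Type*} [NormedAddCommGroup E] [InnerProductSpace ℂ E] [CompleteSpace E]
  {D : E →ₗ.[ℂ] E} (hD : IsSelfAdjoint D)

include hD

/-- On the component at `μ` the two characters differ by at most `|s - t| |μ|`, and `|μ| ‖P_μ x‖ =
‖P_μ (D x)‖`; Bessel's inequality is then applied to `D x`. -/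
theorem IsSelfAdjoint.norm_functionalCalculus_expCharacter_sub_le (s t : ℝ) (x : D.domain) :
    ‖functionalCalculus D (expCharacter s) x - functionalCalculus D (expCharacter t) x‖ ≤
      |s - t| * ‖D x‖ := by
  rw [← hD.functionalCalculus_sub (norm_expCharacter_le s) (norm_expCharacter_le t)]
  refine hD.norm_functionalCalculus_le (B := 2) (fun μ => ?_) (by positivity) fun S => ?_
  · refine (norm_sub_le _ _).trans ?_
    rw [norm_expCharacter, norm_expCharacter]
    norm_num
  · rw [mul_pow]
    refine le_trans ?_ (mul_le_mul_of_nonneg_left (hD.sum_norm_eigenprojection_sq_le (D x) S)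
      (sq_nonneg _))
    rw [Finset.mul_sum]
    refine Finset.sum_le_sum fun μ _ => ?_
    rw [hD.eigenprojection_apply, norm_smul, Complex.norm_real, Real.norm_eq_abs, ← mul_pow,
      ← mul_pow, ← mul_assoc]
    exact pow_le_pow_left₀ (by positivity)
      (mul_le_mul_of_nonneg_right (norm_expCharacter_sub_le s t μ) (norm_nonneg _)) 2

/-- A vector which `exp(-i t D)` moves almost as an eigenvector for `lam` is close to the eigenspace
of the only eigenvalue near `lam`. -/
theorem IsSelfAdjoint.norm_sub_eigenprojection_le {lam ν T c : ℝ} (hT : 0 < T) (hc : 0 ≤ c)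
    {x : E} (hx : functionalCalculus D (expCharacter 0) x = x)
    (hgap : ∀ μ : ℝ, μ ≠ ν → eigenprojection D μ x ≠ 0 → 2 ≤ |μ - lam| * T)
    (h : ∀ t : ℝ, 0 ≤ t → t ≤ T →
      ‖functionalCalculus D (expCharacter (-t)) x - expCharacter (-t) lam • x‖ ≤ c) :
    ‖x - eigenprojection D ν x‖ ≤ c := by
  classical
  -- Bessel's inequality for the displaced vector at time `t` bounds the weighted sum over `S`.
  -- Integrated over `[0, T]`, each weight contributes at least `T`, which cancels against the
  -- length of the interval.
  have key : ∀ S : Finset ℝ, ν ∉ S → ∑ μ ∈ S, ‖eigenprojection D μ x‖ ^ 2 ≤ c ^ 2 := by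
    intro S hS
    have h1 : ∀ t ∈ Set.Icc (0 : ℝ) T, ∑ μ ∈ S, ‖expCharacter t μ - expCharacter t lam‖ ^ 2 *
        ‖eigenprojection D μ x‖ ^ 2 ≤ c ^ 2 := by
      intro t ht
      have h2 := h t ht.1 ht.2
      refine le_trans (le_of_eq ?_) ((hD.sum_norm_eigenprojection_sq_le _ S).trans
        (pow_le_pow_left₀ (norm_nonneg _) h2 2))
      refine Finset.sum_congr rfl fun μ _ => ?_
      rw [map_sub, hD.eigenprojection_functionalCalculus (norm_expCharacter_le _), map_smul,
        ← sub_smul, norm_smul, mul_pow, norm_expCharacter_sub_sq, norm_expCharacter_sub_sq,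
        mul_neg, Real.cos_neg]
    have hcont : ∀ μ : ℝ, Continuous fun t : ℝ => ‖expCharacter t μ - expCharacter t lam‖ ^ 2 *
        ‖eigenprojection D μ x‖ ^ 2 := by
      intro μ
      unfold expCharacter
      fun_prop
    have h3 := intervalIntegral.integral_mono_on hT.le
      (Continuous.intervalIntegrable (μ := MeasureTheory.volume)
        (continuous_finsetSum S fun μ _ => hcont μ) 0 T)
      (intervalIntegrable_const (μ := MeasureTheory.volume)) h1
    rw [intervalIntegral.integral_finsetSum fun μ _ => (hcont μ).intervalIntegrable _ _] at h3
    simp only [intervalIntegral.integral_mul_const, intervalIntegral.integral_const, sub_zero,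
      smul_eq_mul] at h3
    refine le_of_mul_le_mul_left (le_trans ?_ h3) hT
    rw [Finset.mul_sum]
    refine Finset.sum_le_sum fun μ hμ => ?_
    by_cases h0 : eigenprojection D μ x = 0
    · simp [h0]
    · exact mul_le_mul_of_nonneg_right (le_integral_norm_expCharacter_sub_sq
        (hgap μ (fun h => hS (h ▸ hμ)) h0)) (sq_nonneg _)
  have hg : ∀ μ : ℝ, ‖(if μ = ν then 0 else 1 : ℂ)‖ ≤ 1 := by
    intro μ
    split_ifs <;> simp
  -- By `hx`, `x` is the sum of its spectral components, so removing the one at `ν` amounts to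
  -- applying the indicator of the other eigenvalues.
  have h4 : functionalCalculus D (fun μ => if μ = ν then 0 else 1) x =
      x - eigenprojection D ν x := by
    have h5 := hD.functionalCalculus_sub (f := fun _ => 1) (g := fun μ => if μ = ν then 1 else 0)
      (B := 1) (B' := 1) (by simp) (fun μ => by split_ifs <;> simp) x
    rw [← expCharacter_zero, hx] at h5
    have h6 : functionalCalculus D (fun μ => if μ = ν then 1 else 0) x = eigenprojection D ν x := by
      refine (tsum_eq_single ν fun μ hμ => ?_).trans ?_
      · simp [hμ]
      · simp
    rw [h6] at h5
    rw [← h5]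
    congr 1
    funext μ
    split_ifs <;> simp
  rw [← h4]
  refine hD.norm_functionalCalculus_le hg hc fun S => ?_
  refine le_trans ?_ (key (S.erase ν) (Finset.notMem_erase ν S))
  rw [← Finset.sum_erase (a := ν) S (by simp)]
  refine Finset.sum_le_sum fun μ _ => ?_
  exact mul_le_of_le_one_left (sq_nonneg _) (pow_le_one₀ (norm_nonneg _) (hg μ))

end Operator

/-! ### Near-orthogonality, and transfer of vectors between two Hilbert spaces -/

/-- Diagonal dominance of the Gram matrix: in a vanishing combination, pair with the vector whose
coefficient is largest in modulus. -/
theorem linearIndependent_of_norm_inner_sub_le {E : Type*} [NormedAddCommGroup E]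
    [InnerProductSpace ℂ E] {m : ℕ} {v : Fin m → E} {a r : ℝ}
    (h : ∀ i j, ‖inner ℂ (v i) (v j) - (if i = j then (a : ℂ) else 0)‖ ≤ r) (hr : m * r < a) :
    LinearIndependent ℂ v := by
  rw [Fintype.linearIndependent_iff]
  intro g hg
  by_contra! hne
  obtain ⟨k, hk⟩ := hne
  obtain ⟨i, -, hi⟩ := Finset.exists_max_image Finset.univ (fun i => ‖g i‖) ⟨k, Finset.mem_univ k⟩
  have hpos : 0 < ‖g i‖ := (norm_pos_iff.mpr hk).trans_le (hi k (Finset.mem_univ k))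
  have h1 : ∑ j, g j * (inner ℂ (v i) (v j) - (if i = j then (a : ℂ) else 0)) = -(a * g i) := by
    have h2 : ∑ j, g j * inner ℂ (v i) (v j) = 0 := by
      simpa [inner_sum, inner_smul_right] using congrArg (fun w => inner ℂ (v i) w) hg
    simp only [mul_sub, Finset.sum_sub_distrib, h2]
    simp [mul_comm]
  have h3 : ‖(a : ℂ) * g i‖ ≤ ∑ _j : Fin m, ‖g i‖ * r := by
    rw [← norm_neg, ← h1]
    refine norm_sum_le_of_le _ fun j _ => ?_
    rw [norm_mul]
    exact mul_le_mul (hi j (Finset.mem_univ j)) (h i j) (norm_nonneg _) hpos.le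
  rw [norm_mul, Complex.norm_real, Finset.sum_const, Finset.card_univ, Fintype.card_fin,
    nsmul_eq_mul] at h3
  have h4 : a ≤ m * r := by
    refine (le_abs_self a).trans (le_of_mul_le_mul_right ?_ hpos)
    rw [Real.norm_eq_abs] at h3
    linarith
  linarith

section Transfer

variable {E₁ E₂ M : Type*} [NormedAddCommGroup E₁] [InnerProductSpace ℂ E₁]
  [NormedAddCommGroup E₂] [InnerProductSpace ℂ E₂]
  {D₁ : E₁ →ₗ.[ℂ] E₁} {D₂ : E₂ →ₗ.[ℂ] E₂} {B : Set M} {p₁ : M → E₁} {p₂ : M → E₂}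

theorem graphNorm_half_smul_sub_le_one {x y : E₁} (hx : graphNorm D₁ x ≤ 1)
    (hy : graphNorm D₁ y ≤ 1) {c : ℂ} (hc : ‖c‖ = 1) :
    graphNorm D₁ ((1 / 2 : ℂ) • (x - c • y)) ≤ 1 := by
  rw [graphNorm_le_one_iff] at hx hy ⊢
  obtain ⟨hx, hx'⟩ := hx
  obtain ⟨hy, hy'⟩ := hy
  have h : (1 / 2 : ℂ) • (x - c • y) ∈ D₁.domain :=
    D₁.domain.smul_mem _ (D₁.domain.sub_mem hx (D₁.domain.smul_mem c hy))
  refine ⟨h, ?_⟩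
  have h1 : (⟨_, h⟩ : D₁.domain) = (1 / 2 : ℂ) • (⟨x, hx⟩ - c • ⟨y, hy⟩) := rfl
  rw [h1, D₁.map_smul, D₁.map_sub, D₁.map_smul, norm_smul, norm_smul]
  have h2 := norm_sub_le x (c • y)
  have h3 := norm_sub_le (D₁ ⟨x, hx⟩) (c • D₁ ⟨y, hy⟩)
  rw [norm_smul, hc, one_mul] at h2 h3
  norm_num
  linarith

/-- Two pairs of vectors which induce almost the same functionals on a common set `B` have almost
the same inner products. -/
theorem norm_inner_sub_inner_le {ε κ : ℝ}
    (hlift₁ : ∀ x, graphNorm D₁ x ≤ 1 → ∃ ω ∈ B, p₁ ω = (1 / 2 : ℂ) • x)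
    (hlift₂ : ∀ y, graphNorm D₂ y ≤ 1 → ∃ ω ∈ B, p₂ ω = (1 / 2 : ℂ) • y)
    (hinner : ∀ ω ∈ B, ∀ ρ ∈ B, ‖inner ℂ (p₁ ω) (p₁ ρ) - inner ℂ (p₂ ω) (p₂ ρ)‖ ≤ κ)
    {ξ ξ' : E₁} {η η' : E₂} (hξ : graphNorm D₁ ξ ≤ 1) (hη' : graphNorm D₂ η' ≤ 1)
    (h : ∀ ω ∈ B, ‖inner ℂ ξ (p₁ ω) - inner ℂ η (p₂ ω)‖ ≤ ε)
    (h' : ∀ ω ∈ B, ‖inner ℂ ξ' (p₁ ω) - inner ℂ η' (p₂ ω)‖ ≤ ε) :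
    ‖inner ℂ η η' - inner ℂ ξ ξ'‖ ≤ 4 * (ε + κ) := by
  -- Chain of approximations: `⟨η, η'⟩ = 2⟨η, p₂ ω⟩ ≈ 2⟨ξ, p₁ ω⟩ = 4⟨p₁ ρ, p₁ ω⟩ ≈ 4⟨p₂ ρ, p₂ ω⟩ =
  -- 2⟨p₂ ρ, η'⟩ ≈ 2⟨p₁ ρ, ξ'⟩ = ⟨ξ, ξ'⟩`. The errors are `2ε`, `4κ` and `2ε`.
  obtain ⟨ω, hω, hω'⟩ := hlift₂ η' hη'
  obtain ⟨ρ, hρ, hρ'⟩ := hlift₁ ξ hξ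
  have e1 : η' = (2 : ℂ) • p₂ ω := by rw [hω', smul_smul]; norm_num
  have e2 : ξ = (2 : ℂ) • p₁ ρ := by rw [hρ', smul_smul]; norm_num
  have h1 := h ω hω
  have h2 := hinner ρ hρ ω hω
  have h3 := h' ρ hρ
  rw [← norm_star, star_sub] at h3
  simp only [← starRingEnd_apply, inner_conj_symm] at h3
  have e3 : inner ℂ η η' - inner ℂ ξ ξ' =
      -(2 * (inner ℂ ξ (p₁ ω) - inner ℂ η (p₂ ω))) +
        4 * (inner ℂ (p₁ ρ) (p₁ ω) - inner ℂ (p₂ ρ) (p₂ ω)) +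
        -(2 * (inner ℂ (p₁ ρ) ξ' - inner ℂ (p₂ ρ) η')) := by
    have a1 : inner ℂ η η' = 2 * inner ℂ η (p₂ ω) := by rw [e1, inner_smul_right]
    have a2 : inner ℂ (p₂ ρ) η' = 2 * inner ℂ (p₂ ρ) (p₂ ω) := by rw [e1, inner_smul_right]
    have a3 : inner ℂ ξ ξ' = 2 * inner ℂ (p₁ ρ) ξ' := by
      conv_lhs => rw [e2, inner_smul_left, map_ofNat]
    have a4 : inner ℂ ξ (p₁ ω) = 2 * inner ℂ (p₁ ρ) (p₁ ω) := by
      conv_lhs => rw [e2, inner_smul_left, map_ofNat]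
    rw [a1, a2, a3, a4]
    ring
  rw [e3]
  refine (norm_add₃_le).trans ?_
  rw [norm_neg, norm_neg, norm_mul, norm_mul, norm_mul]
  norm_num
  linarith

variable [CompleteSpace E₁] [CompleteSpace E₂]

/-- A vector which induces almost the same orbit of functionals as an eigenvector is moved almost
as an eigenvector, up to a projection. -/
theorem exists_norm_functionalCalculus_sub_smul_le (hD₁ : IsSelfAdjoint D₁)
    (hD₂ : IsSelfAdjoint D₂) {ε lam : ℝ} (hε : 0 < ε)
    (hlift₂ : ∀ y, graphNorm D₂ y ≤ 1 → ∃ ω ∈ B, p₂ ω = (1 / 2 : ℂ) • y)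
    {ς : ℝ≥0 → ℝ≥0} (h0 : ς 0 = 0) (hς : ∀ t : ℝ≥0, (t : ℝ) ≤ 1 / ε → |(ς t : ℝ) - t| ≤ ε)
    {ξ : E₁} (hξ : ξ ∈ opEigenspace D₁ lam) {η : E₂} (hη : graphNorm D₂ η ≤ 1)
    (hreach : ∀ t : ℝ≥0, (t : ℝ) ≤ 1 / ε → ∀ ω ∈ B,
      ‖inner ℂ (functionalCalculus D₁ (expCharacter (-t)) ξ) (p₁ ω) -
        inner ℂ (functionalCalculus D₂ (expCharacter (-(ς t))) η) (p₂ ω)‖ ≤ ε) :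
    ∃ ζ : E₂, graphNorm D₂ ζ ≤ 1 ∧ functionalCalculus D₂ (expCharacter 0) ζ = ζ ∧
      (∀ ω ∈ B, ‖inner ℂ ξ (p₁ ω) - inner ℂ ζ (p₂ ω)‖ ≤ ε) ∧
      ∀ t : ℝ, 0 ≤ t → t ≤ 1 / ε →
        ‖functionalCalculus D₂ (expCharacter (-t)) ζ - expCharacter (-t) lam • ζ‖ ≤
          √(8 * ε) + ε := by
  -- `ζ` is the sum of the spectral components of `η`; it has the same orbit as `η` and satisfies
  -- the reconstruction hypothesis of `IsSelfAdjoint.norm_sub_eigenprojection_le`.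
  set ζ := functionalCalculus D₂ (expCharacter 0) η with hζdef
  have hζ : graphNorm D₂ ζ ≤ 1 :=
    hD₂.graphNorm_functionalCalculus_le_one (norm_expCharacter_le 0) hη
  have horbit : ∀ s, functionalCalculus D₂ (expCharacter s) ζ =
      functionalCalculus D₂ (expCharacter s) η := by
    intro s
    rw [hζdef, hD₂.functionalCalculus_functionalCalculus (norm_expCharacter_le 0),
      expCharacter_zero]
    simp only [mul_one]
  have hmove : ∀ s, functionalCalculus D₁ (expCharacter s) ξ = expCharacter s lam • ξ :=
    fun s => hD₁.functionalCalculus_of_mem_opEigenspace _ hξ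
  have hzero : ∀ ω ∈ B, ‖inner ℂ ξ (p₁ ω) - inner ℂ ζ (p₂ ω)‖ ≤ ε := by
    intro ω hω
    have := hreach 0 (by simpa using hε.le) ω hω
    rw [hmove, h0] at this
    simpa [expCharacter_zero, hζdef] using this
  refine ⟨ζ, hζ, horbit 0, hzero, fun t ht ht' => ?_⟩
  lift t to ℝ≥0 using ht
  set c := expCharacter (-t) lam with hc
  have hc1 : ‖c‖ = 1 := norm_expCharacter _ _
  set x := functionalCalculus D₂ (expCharacter (-(ς t))) ζ - c • ζ with hx
  have hxn : ‖x‖ ≤ √(8 * ε) := by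
    -- The displacement `x` is tested against itself: `ω` lifts `x / 4`, one half bringing `x` into
    -- the unit ball and the other coming from the lift. Comparison at times `t` and `0` gives `‖x‖²
    -- / 4 ≤ 2ε`.
    obtain ⟨ω, hω, hpω⟩ := hlift₂ ((1 / 2 : ℂ) • x) (graphNorm_half_smul_sub_le_one
      (hD₂.graphNorm_functionalCalculus_le_one (norm_expCharacter_le _) hζ) hζ hc1)
    have h1 := hreach t ht' ω hω
    have h2 := hzero ω hω
    rw [hmove, ← hc, ← horbit, inner_smul_left] at h1
    have h3 : inner ℂ x (p₂ ω) = -(starRingEnd ℂ c * inner ℂ ξ (p₁ ω) -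
        inner ℂ (functionalCalculus D₂ (expCharacter (-(ς t))) ζ) (p₂ ω)) +
        starRingEnd ℂ c * (inner ℂ ξ (p₁ ω) - inner ℂ ζ (p₂ ω)) := by
      rw [hx, inner_sub_left, inner_smul_left]
      ring
    have h4 : ‖inner ℂ x (p₂ ω)‖ ≤ 2 * ε := by
      rw [h3]
      refine (norm_add_le _ _).trans ?_
      rw [norm_neg, norm_mul, RCLike.norm_conj, hc1]
      linarith
    have h5 : ‖inner ℂ x (p₂ ω)‖ = ‖x‖ ^ 2 / 4 := by
      rw [hpω, inner_smul_right, inner_smul_right, inner_self_eq_norm_sq_to_K]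
      simp
      ring
    refine Real.le_sqrt_of_sq_le ?_
    linarith
  obtain ⟨hdom, hζ1⟩ := graphNorm_le_one_iff.mp hζ
  -- Replacing the time `ς t` by `t` costs at most `ε`, since `‖D₂ ζ‖ ≤ 1`.
  have hshift := hD₂.norm_functionalCalculus_expCharacter_sub_le (-t) (-(ς t)) ⟨ζ, hdom⟩
  have hle : |(-(t : ℝ)) - (-(ς t))| * ‖D₂ ⟨ζ, hdom⟩‖ ≤ ε := by
    have e : -(t : ℝ) - -(ς t) = ς t - t := by ring
    rw [e]
    have := norm_nonneg ζ
    exact (mul_le_of_le_one_right (abs_nonneg _) (by linarith)).trans (hς t ht')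
  have e : functionalCalculus D₂ (expCharacter (-t)) ζ - c • ζ =
      x + (functionalCalculus D₂ (expCharacter (-t)) ζ -
        functionalCalculus D₂ (expCharacter (-(ς t))) ζ) := by
    rw [hx]
    abel
  rw [e]
  exact (norm_add_le _ _).trans (add_le_add hxn (hshift.trans hle))

end Transfer

/-! ### Consequences of the extent and of the reach of a tunnel -/

theorem coe_mem_stateFunctions {B : Type*} [CStarAlgebra B] (θ : B →⋆ₐ[ℂ] ℂ) :
    (θ : B → ℂ) ∈ stateFunctions B := by
  let φ : B →L[ℂ] ℂ := LinearMap.mkContinuous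
    { toFun := θ, map_add' := map_add θ, map_smul' := map_smul θ } 1 fun b => by
      simpa using NonUnitalStarAlgHom.norm_apply_le θ b
  refine ⟨StrongDual.toWeakDual φ, ⟨map_one θ, fun b => ⟨‖θ b‖ ^ 2, sq_nonneg _, ?_⟩⟩, rfl⟩
  change θ (star b * b) = _
  rw [map_mul, map_star, Complex.star_def, Complex.conj_mul']
  push_cast
  rfl

theorem eq_id_of_mem_stateFunctions {φ : ℂ → ℂ} (hφ : φ ∈ stateFunctions ℂ) : φ = id := by
  obtain ⟨ψ, ⟨h1, -⟩, rfl⟩ := hφ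
  funext z
  have := map_smul ψ z (1 : ℂ)
  rw [h1] at this
  simpa using this

/-- The only state of `ℂ` is the identity, so the states factoring through `θ` reduce to `θ` alone,
while `θ'` is a state of `B`. -/
theorem kantorovich_le_stateExtent {B : Type*} [CStarAlgebra B] (L : B → ℝ≥0∞)
    (θ θ' : B →⋆ₐ[ℂ] ℂ) : kantorovich L θ' θ ≤ stateExtent L θ := by
  refine le_trans ?_ (le_max_right _ _)
  refine le_trans ?_ (le_iSup₂ (θ' : B → ℂ) (coe_mem_stateFunctions θ'))
  refine le_iInf₂ fun ψ hψ => ?_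
  obtain ⟨φ, hφ, rfl⟩ := hψ
  rw [eq_id_of_mem_stateFunctions hφ]
  rfl

theorem norm_sub_le_of_kantorovich_le {X : Type*} {N : X → ℝ≥0∞} {φ ψ : X → ℂ} {ε : ℝ}
    (hε : 0 ≤ ε) (h : kantorovich N φ ψ ≤ ENNReal.ofReal ε) {x : X} (hx : N x ≤ 1) :
    ‖φ x - ψ x‖ ≤ ε := by
  have h1 : ‖φ x - ψ x‖ₑ ≤ kantorovich N φ ψ :=
    le_iSup₂ (f := fun x (_ : x ∈ {x | N x ≤ 1}) => ‖φ x - ψ x‖ₑ) x hx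
  have h2 := h1.trans h
  rwa [← ofReal_norm, ENNReal.ofReal_le_ofReal_iff hε] at h2

theorem IsQCMS.norm_sub_le {F K : ℝ≥0} {B : Type*} [CStarAlgebra B] {L : B → ℝ≥0∞}
    (hL : IsQCMS F K B L) {θ θ' : B →⋆ₐ[ℂ] ℂ} {ε : ℝ} (hε : 0 ≤ ε)
    (h : kantorovich L θ θ' ≤ ENNReal.ofReal ε) {H : ℝ≥0} (hH : 0 < H) {b : B} (hb : L b ≤ H) :
    ‖θ b - θ' b‖ ≤ H * ε := by
  have h1 : L (((H : ℝ)⁻¹ : ℝ) • b) ≤ 1 := by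
    have h2 := hL.smul ((H : ℝ)⁻¹) b
    have h3 : ‖(H : ℝ)⁻¹‖ₑ = (H : ℝ≥0∞)⁻¹ := by
      rw [enorm_inv (by exact_mod_cast hH.ne')]
      simp
    rw [Complex.coe_smul, h3] at h2
    rw [h2]
    calc (H : ℝ≥0∞)⁻¹ * L b ≤ (H : ℝ≥0∞)⁻¹ * H := by gcongr
      _ ≤ 1 := ENNReal.inv_mul_le_one _
  have h4 := norm_sub_le_of_kantorovich_le hε h h1
  have h5 : (((H : ℝ)⁻¹ : ℝ) • b) = ((H : ℝ)⁻¹ : ℂ) • b := by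
    rw [← Complex.coe_smul]
    push_cast
    rfl
  rw [h5, map_smul, map_smul, ← smul_sub, norm_smul, norm_inv, Complex.norm_real,
    Real.norm_of_nonneg H.coe_nonneg] at h4
  rwa [inv_mul_le_iff₀ (by exact_mod_cast hH)] at h4

section Tunnel

variable {F K G H : ℝ≥0}

/-- The inner Leibniz inequality bounds the seminorms of the real and imaginary parts by `H`; each
part contributes `H * ε`. -/
theorem Correspondence.IsMetrical.norm_map_ip_sub_le {J : Correspondence.{u, v}}
    (hJ : J.IsMetrical F K G H) (hH : 0 < H) {θ θ' : J.B →⋆ₐ[ℂ] ℂ} {ε : ℝ} (hε : 0 ≤ ε)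
    (h : kantorovich J.LB θ θ' ≤ ENNReal.ofReal ε) {ω ρ : J.M} (hω : J.DN ω ≤ 1)
    (hρ : J.DN ρ ≤ 1) : ‖θ (J.ip ω ρ) - θ' (J.ip ω ρ)‖ ≤ 2 * H * ε := by
  have h1 := hJ.inner_leibniz ω ρ (hω.trans_lt ENNReal.one_lt_top) (hρ.trans_lt ENNReal.one_lt_top)
  have h2 : (H : ℝ≥0∞) * J.DN ω * J.DN ρ ≤ H := by
    calc (H : ℝ≥0∞) * J.DN ω * J.DN ρ ≤ H * 1 * 1 := by gcongr
      _ = H := by simp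
  have h3 := hJ.qcmsB.norm_sub_le hε h hH ((le_max_left _ _).trans (h1.trans h2))
  have h4 := hJ.qcmsB.norm_sub_le hε h hH ((le_max_right _ _).trans (h1.trans h2))
  have h5 : θ (J.ip ω ρ) - θ' (J.ip ω ρ) =
      (θ (realPart (J.ip ω ρ)) - θ' (realPart (J.ip ω ρ))) +
        Complex.I * (θ (imaginaryPart (J.ip ω ρ)) - θ' (imaginaryPart (J.ip ω ρ))) := by
    conv_lhs => rw [← realPart_add_I_smul_imaginaryPart (J.ip ω ρ)]
    rw [map_add, map_add, map_smul, map_smul, smul_eq_mul, smul_eq_mul]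
    ring
  rw [h5]
  refine (norm_add_le _ _).trans ?_
  rw [norm_mul, Complex.norm_I, one_mul]
  linarith

/-- The module map of a modular quantum isometry, with values in the Hilbert space of a spectral
triple. -/
noncomputable def ModularQuantumIsometry.toHilbert {J : Correspondence.{u', v'}}
    {T : SpectralTriple.{u}}
    (p : ModularQuantumIsometry J T.mcc) (ω : J.M) : T.E := p.toModule ω

/-- The factor `1/2` makes the quotient norm strictly less than `1`, so a preimage in the unit ball
exists without the infimum having to be attained. -/
theorem ModularQuantumIsometry.exists_lift {J : Correspondence.{u', v'}} {T : SpectralTriple.{u}}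
    (p : ModularQuantumIsometry J T.mcc) {x : T.E} (hx : graphNorm T.D x ≤ 1) :
    ∃ ω ∈ {ω | J.DN ω ≤ 1}, p.toHilbert ω = (1 / 2 : ℂ) • x := by
  have h1 : graphNorm T.D ((1 / 2 : ℂ) • x) < 1 := by
    rw [graphNorm_smul (by norm_num)]
    refine (mul_le_mul_right hx _).trans_lt ?_
    rw [mul_one, ← ofReal_norm]
    norm_num
  have h2 := p.quotientM ((1 / 2 : ℂ) • x) (h1.trans ENNReal.one_lt_top)
  change graphNorm T.D ((1 / 2 : ℂ) • x) = _ at h2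
  rw [h2] at h1
  simp only [iInf_lt_iff] at h1
  obtain ⟨ω, hω, h⟩ := h1
  exact ⟨ω, h.le, hω⟩

variable {T₁ T₂ : SpectralTriple.{u}}

theorem Tunnel.norm_inner_sub_inner_le (τ : Tunnel F K G H T₁.mcc T₂.mcc) (hH : 0 < H) {ε : ℝ}
    (hε : 0 ≤ ε) (h : τ.extent ≤ ENNReal.ofReal ε) {ω ρ : τ.J.M} (hω : τ.J.DN ω ≤ 1)
    (hρ : τ.J.DN ρ ≤ 1) :
    ‖inner ℂ (τ.fst.toHilbert ω) (τ.fst.toHilbert ρ) -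
      inner ℂ (τ.snd.toHilbert ω) (τ.snd.toHilbert ρ)‖ ≤ 2 * H * ε := by
  let θ₁ : τ.J.B →⋆ₐ[ℂ] ℂ := τ.fst.toB
  let θ₂ : τ.J.B →⋆ₐ[ℂ] ℂ := τ.snd.toB
  have h1 : kantorovich τ.J.LB θ₁ θ₂ ≤ ENNReal.ofReal ε :=
    (kantorovich_le_stateExtent τ.J.LB θ₂ θ₁).trans
      (((le_max_right _ _).trans (le_max_right _ _)).trans h)
  have h2 := τ.metrical.norm_map_ip_sub_le hH hε h1 hω hρ
  have e1 : θ₁ (τ.J.ip ω ρ) = inner ℂ (τ.fst.toHilbert ω) (τ.fst.toHilbert ρ) := τ.fst.map_ip ω ρ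
  have e2 : θ₂ (τ.J.ip ω ρ) = inner ℂ (τ.snd.toHilbert ω) (τ.snd.toHilbert ρ) := τ.snd.map_ip ω ρ
  rwa [e1, e2] at h2

theorem Tunnel.exists_norm_inner_sub_inner_le (τ : Tunnel F K G H T₁.mcc T₂.mcc) {ς : ℝ≥0 → ℝ≥0}
    {ε : ℝ} (hε : 0 ≤ ε) (h : τ.halfReach ς ε < ENNReal.ofReal ε) {ξ : T₁.E}
    (hξ : graphNorm T₁.D ξ ≤ 1) :
    ∃ η : T₂.E, graphNorm T₂.D η ≤ 1 ∧
      ∀ t : ℝ≥0, (t : ℝ) ≤ 1 / ε → ∀ ω ∈ {ω | τ.J.DN ω ≤ 1},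
        ‖inner ℂ (functionalCalculus T₁.D (expCharacter (-t)) ξ) (τ.fst.toHilbert ω) -
          inner ℂ (functionalCalculus T₂.D (expCharacter (-(ς t))) η)
            (τ.snd.toHilbert ω)‖ ≤ ε := by
  have h1 := (le_iSup₂ (f := fun x (_ : x ∈ ((fun (ξ : T₁.E) (t : {t : ℝ≥0 // (t : ℝ) ≤ 1 / ε})
      (ω : τ.J.M) => T₁.mcc.ip (T₁.U (-(t.1 : ℝ)) ξ) (τ.fst.toModule ω)) ''
        {ξ | graphNorm T₁.D ξ ≤ 1})) => ⨅ y ∈ ((fun (ξ : T₂.E)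
          (t : {t : ℝ≥0 // (t : ℝ) ≤ 1 / ε}) (ω : τ.J.M) =>
            T₂.mcc.ip (T₂.U (-(ς t.1 : ℝ)) ξ) (τ.snd.toModule ω)) ''
              {ξ | graphNorm T₂.D ξ ≤ 1}), kantorovichFamily τ.J.DN x y) _
    (Set.mem_image_of_mem _ hξ)).trans_lt h
  simp only [iInf_lt_iff] at h1
  obtain ⟨_, ⟨η, hη, rfl⟩, h2⟩ := h1
  refine ⟨η, hη, fun t ht ω hω => ?_⟩
  have h3 := (le_iSup _ (⟨t, ht⟩ : {t : ℝ≥0 // (t : ℝ) ≤ 1 / ε})).trans h2.le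
  exact norm_sub_le_of_kantorovich_le hε h3 hω

end Tunnel

/-- The defining inequality at `x = t`, `y = z = 0`. -/
theorem IsIsoIso.abs_sub_le {ε : ℝ} {ς₁ ς₂ : ℝ≥0 → ℝ≥0} (h : IsIsoIso ε ς₁ ς₂) (hε : 0 < ε)
    {t : ℝ≥0} (ht : (t : ℝ) ≤ 1 / ε) : |(ς₂ t : ℝ) - t| ≤ ε := by
  obtain ⟨h1, h2, h3⟩ := h
  have h0 : ((0 : ℝ≥0) : ℝ) ≤ 1 / ε := by simpa using hε.le
  have := (h3 t 0 0 ht h0 h0).2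
  simp only [h1, h2, NNReal.coe_zero, add_zero, sub_zero, NNReal.abs_eq] at this
  exact this.le

/-! ### Lower bounds for multiplicities and the main theorem -/

section Multiplicity

variable {F K G H : ℝ≥0} {T₁ T₂ : SpectralTriple.{u}}

theorem graphNorm_of_mem_opEigenspace {E : Type*} [NormedAddCommGroup E] [InnerProductSpace ℂ E]
    {D : E →ₗ.[ℂ] E} {lam : ℝ} {x : E} (hx : x ∈ opEigenspace D lam)
    (h : (1 + |lam|) * ‖x‖ ≤ 1) : graphNorm D x ≤ 1 := by
  obtain ⟨hd, hx⟩ := hx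
  refine graphNorm_le_one_iff.mpr ⟨hd, ?_⟩
  rw [hx, norm_smul, Complex.norm_real, Real.norm_eq_abs]
  linarith

theorem natCast_le_multiplicityAt {E : Type*} [NormedAddCommGroup E] [InnerProductSpace ℂ E]
    {D : E →ₗ.[ℂ] E} {z : ℂ} {m : ℕ} {v : Fin m → E} (hv : ∀ i, v i ∈ opEigenspace D z)
    (hli : LinearIndependent ℂ v) : (m : ℕ∞) ≤ multiplicityAt z D := by
  have h : LinearIndependent ℂ fun i => (⟨v i, hv i⟩ : opEigenspace D z) :=
    LinearIndependent.of_comp (opEigenspace D z).subtype hli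
  refine Cardinal.natCast_le_toENat.mpr ?_
  simpa using h.cardinal_lift_le_rank

theorem exists_orthonormal_of_natCast_le_multiplicityAt {E : Type*} [NormedAddCommGroup E]
    [InnerProductSpace ℂ E] {D : E →ₗ.[ℂ] E} {z : ℂ} {m : ℕ}
    (h : (m : ℕ∞) ≤ multiplicityAt z D) :
    ∃ e : Fin m → E, Orthonormal ℂ e ∧ ∀ i, e i ∈ opEigenspace D z := by
  obtain ⟨f, hf⟩ := Module.le_rank_iff.mp (Cardinal.natCast_le_toENat.mp h)
  have he := InnerProductSpace.gramSchmidtNormed_orthonormal (𝕜 := ℂ) hf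
  exact ⟨(opEigenspace D z).subtypeₗᵢ ∘ InnerProductSpace.gramSchmidtNormed ℂ f,
    he.comp_linearIsometry _, fun i => (InnerProductSpace.gramSchmidtNormed ℂ f i).2⟩

theorem Tunnel.natCast_le_multiplicityAt (τ : Tunnel F K G H T₁.mcc T₂.mcc) (hH : 0 < H)
    {ς : ℝ≥0 → ℝ≥0} {ε lam δ ν : ℝ} (hε : 0 < ε) (hextent : τ.extent ≤ ENNReal.ofReal ε)
    (hreach : τ.halfReach ς ε < ENNReal.ofReal ε) (h0 : ς 0 = 0)
    (hς : ∀ t : ℝ≥0, (t : ℝ) ≤ 1 / ε → |(ς t : ℝ) - t| ≤ ε)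
    (hgap : ∀ μ : ℝ, (μ : ℂ) ∈ opSpectrum T₂.D → |μ - lam| < δ → μ = ν) (hδ : 2 * ε ≤ δ)
    {m : ℕ} (hsmall : m * (4 * (ε + 2 * H * ε) + (√(8 * ε) + ε)) < ((1 + |lam|)⁻¹) ^ 2)
    (hm : (m : ℕ∞) ≤ multiplicityAt (lam : ℂ) T₁.D) :
    (m : ℕ∞) ≤ multiplicityAt (ν : ℂ) T₂.D := by
  obtain ⟨e, he, hmem⟩ := exists_orthonormal_of_natCast_le_multiplicityAt hm
  -- A unit eigenvector for `lam` has graph norm `1 + |lam|`; scaling by `a` brings it into the unit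
  -- ball.
  set a : ℝ := (1 + |lam|)⁻¹ with ha
  have hapos : 0 < a := by positivity
  have hξmem : ∀ i, (a : ℂ) • e i ∈ opEigenspace T₁.D lam :=
    fun i => Submodule.smul_mem _ _ (hmem i)
  have hξ : ∀ i, graphNorm T₁.D ((a : ℂ) • e i) ≤ 1 := by
    refine fun i => graphNorm_of_mem_opEigenspace (hξmem i) ?_
    rw [norm_smul, he.1, mul_one, Complex.norm_real, Real.norm_of_nonneg hapos.le, ha,
      mul_inv_cancel₀ (by positivity)]
  have hex : ∀ i, ∃ ζ : T₂.E, graphNorm T₂.D ζ ≤ 1 ∧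
      functionalCalculus T₂.D (expCharacter 0) ζ = ζ ∧
      (∀ ω ∈ {ω | τ.J.DN ω ≤ 1}, ‖inner ℂ ((a : ℂ) • e i) (τ.fst.toHilbert ω) -
        inner ℂ ζ (τ.snd.toHilbert ω)‖ ≤ ε) ∧
      ∀ t : ℝ, 0 ≤ t → t ≤ 1 / ε →
        ‖functionalCalculus T₂.D (expCharacter (-t)) ζ - expCharacter (-t) lam • ζ‖ ≤
          √(8 * ε) + ε := by
    intro i
    obtain ⟨η, hη, hη'⟩ := τ.exists_norm_inner_sub_inner_le hε.le hreach (hξ i)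
    exact exists_norm_functionalCalculus_sub_smul_le T₁.selfAdjoint T₂.selfAdjoint hε
      (fun y hy => τ.snd.exists_lift hy) h0 hς (hξmem i) hη hη'
  choose ζ hζ hζ0 hζinner hζmove using hex
  have hc : 0 ≤ √(8 * ε) + ε := by positivity
  have hclose : ∀ i, ‖ζ i - eigenprojection T₂.D ν (ζ i)‖ ≤ √(8 * ε) + ε := by
    intro i
    refine T₂.selfAdjoint.norm_sub_eigenprojection_le (T := 1 / ε) (by positivity) hc (hζ0 i)
      (fun μ hμ hne => ?_) (hζmove i)
    -- The observation time is `1 / ε`, so a gap of `δ ≥ 2ε` suffices for the averaging.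
    have h1 : δ ≤ |μ - lam| := by
      by_contra! hlt
      exact hμ (hgap μ (mem_opSpectrum_of_mem_opEigenspace
        (T₂.selfAdjoint.eigenprojection_mem _ _) hne) hlt)
    rw [mul_one_div, le_div_iff₀ hε]
    linarith
  refine _root_.natCast_le_multiplicityAt
    (v := fun i => eigenprojection T₂.D ν (ζ i)) (fun i => T₂.selfAdjoint.eigenprojection_mem _ _)
    (linearIndependent_of_norm_inner_sub_le (a := a ^ 2) (fun i j => ?_) hsmall)
  have hgram := _root_.norm_inner_sub_inner_le (B := {ω | τ.J.DN ω ≤ 1})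
    (p₁ := τ.fst.toHilbert) (p₂ := τ.snd.toHilbert)
    (fun x hx => τ.fst.exists_lift hx) (fun y hy => τ.snd.exists_lift hy)
    (fun ω hω ρ hρ => τ.norm_inner_sub_inner_le hH hε.le hextent hω hρ)
    (hξ i) (hζ j) (hζinner i) (hζinner j)
  have h1 : inner ℂ ((a : ℂ) • e i) ((a : ℂ) • e j) =
      if i = j then ((a ^ 2 : ℝ) : ℂ) else 0 := by
    rw [inner_smul_left, inner_smul_right, orthonormal_iff_ite.mp he i j, Complex.conj_ofReal]
    split_ifs
    · push_cast
      ring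
    · simp
  have hζ1 : ‖ζ j‖ ≤ 1 := by
    obtain ⟨hd, h⟩ := graphNorm_le_one_iff.mp (hζ j)
    have := norm_nonneg (T₂.D ⟨ζ j, hd⟩)
    linarith
  have h2 : ‖inner ℂ (ζ i - eigenprojection T₂.D ν (ζ i)) (ζ j)‖ ≤ √(8 * ε) + ε :=
    (norm_inner_le_norm _ _).trans
      ((mul_le_of_le_one_right (norm_nonneg _) hζ1).trans (hclose i))
  -- Since the projection is symmetric and idempotent, projecting both vectors has the effect of
  -- projecting one, so the error enters only once.
  have h3 : inner ℂ (eigenprojection T₂.D ν (ζ i)) (eigenprojection T₂.D ν (ζ j)) =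
      inner ℂ (ζ i) (ζ j) - inner ℂ (ζ i - eigenprojection T₂.D ν (ζ i)) (ζ j) := by
    rw [inner_eigenprojection_left (T₂.selfAdjoint.eigenprojection_mem _ _), inner_sub_left,
      inner_eigenprojection_comm]
    ring
  rw [h1] at hgram
  rw [h3, sub_right_comm]
  exact (norm_sub_le _ _).trans (add_le_add hgram h2)

end Multiplicity

theorem mainTheorem4 (F K G H : ℝ≥0) (hF : 1 ≤ F) (hG : 1 ≤ G) (hH : 2 ≤ H)
    (T : ℕ → SpectralTriple.{u}) (Tlim : SpectralTriple.{u})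
    (hT : ∀ n, (T n).IsMetric F K) (hTlim : Tlim.IsMetric F K)
    (hconv : Tendsto (fun n => spectralPropinquity F K G H (T n) Tlim) atTop (𝓝 0))
    (lam : ℝ) (hlam : (lam : ℂ) ∈ opSpectrum Tlim.D)
    (δ : ℝ) (hδ : 0 < δ) (N : ℕ) (lamSeq : ℕ → ℝ)
    (hsingle : ∀ n, N ≤ n →
      {x : ℝ | x ∈ Set.Ioo (lam - δ) (lam + δ) ∧ (x : ℂ) ∈ opSpectrum (T n).D} = {lamSeq n}) :
    multiplicityAt (lam : ℂ) Tlim.D ≤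
      liminf (fun n => multiplicityAt (lamSeq n : ℂ) (T n).D) atTop := by
  -- Testing against finite `m` also covers an infinite value and makes the smallness condition on
  -- `ε` independent of `n`.
  refine ENat.forall_natCast_le_iff_le.mp fun m hm => ?_
  have hcont : ∀ᶠ ε in 𝓝 (0 : ℝ), m * (4 * (ε + 2 * H * ε) + (√(8 * ε) + ε)) <
      ((1 + |lam|)⁻¹) ^ 2 := by
    have h1 : Continuous fun ε : ℝ => m * (4 * (ε + 2 * H * ε) + (√(8 * ε) + ε)) := by fun_prop
    refine (h1.tendsto 0).eventually_lt_const ?_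
    simp only [mul_zero, add_zero, Real.sqrt_zero]
    positivity
  obtain ⟨r, hr, hball⟩ := Metric.eventually_nhds_iff.mp hcont
  -- Staying below `√2 / 2` rules out the default value in the infimum; `r` gives the Gram estimate,
  -- and `δ / 2` the spectral gap.
  have hev := hconv.eventually_lt_const (show (0 : ℝ) < min (√2 / 2) (min r (δ / 2)) by positivity)
  refine le_liminf_of_le (by isBoundedDefault) ?_
  filter_upwards [hev, eventually_ge_atTop N] with n hn hNn
  obtain ⟨ε, hεmem, hεlt⟩ := exists_lt_of_csInf_lt (Set.insert_nonempty _ _) hn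
  obtain ⟨hε1, hε2, hε3⟩ : ε < √2 / 2 ∧ ε < r ∧ ε < δ / 2 := by simpa using hεlt
  obtain rfl | ⟨hε, τ, ς₁, ς₂, hς, hmag⟩ := hεmem
  · exact absurd hε1 (lt_irrefl _)
  -- The tunnel is reversed because eigenvectors go from the limit to `T n`; this uses the half of
  -- the reach involving `ς₂`.
  have hextent : τ.symm.extent ≤ ENNReal.ofReal ε := by
    refine le_trans (le_of_eq ?_) ((le_max_left _ _).trans hmag.le)
    exact max_comm _ _
  have hreach : τ.symm.halfReach ς₂ ε < ENNReal.ofReal ε :=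
    ((le_max_right _ _).trans (le_max_right _ _)).trans_lt hmag
  refine τ.symm.natCast_le_multiplicityAt (lt_of_lt_of_le (by norm_num) hH) hε hextent hreach
    hς.2.1 (fun t ht => hς.abs_sub_le hε ht) (fun μ hμ hlt => ?_) (δ := δ) (by linarith)
    (hball (by rwa [Real.dist_eq, sub_zero, abs_of_pos hε])) hm
  have h1 : μ ∈ {x : ℝ | x ∈ Set.Ioo (lam - δ) (lam + δ) ∧ (x : ℂ) ∈ opSpectrum (T n).D} := by
    rw [abs_lt] at hlt
    exact ⟨⟨by linarith, by linarith⟩, hμ⟩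
  rw [hsingle n hNn] at h1
  exact h1
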